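/- A cellular automaton (CA) $\mathcal A=(S,r,f)$ consists of a finite state set $S$, a radius $r\in\mathbb N$ and a local rule $f:S^{2r+1}\to S$. Its iterates $f^n:S^{2rn+1}\to S$ are defined by $f^1=f$ and $f^n(w_1\ldots w_{2rn+1})=f^{n-1}\bigl(f(w_1\ldots w_{2r+1})\,f(w_2\ldots w_{2r+2})\cdots f(w_{2r(n-1)+1}\ldots w_{2rn+1})\bigr)$ for $n\ge 2$. For $0\le i\le 2rn+1$ let $f^n_i:S^i\times S^{2rn+1-i}\to S$ be $f^n$ with the first $i$ letters of the input given to Alice and the others to Bob. A protocol over $X\times Y$ with range $Z$ is a finite binary tree in which every internal node is labelled by a map $X\to\{0,1\}$ (Alice speaks) or $Y\to\{0,1\}$ (Bob speaks), and every leaf by a map $X\to Z$ (Alice answers) or $Y\to Z$ (Bob answers). On input $(x,y)$ one walks from the root, going left on bit $0$ and right on bit $1$, and the value is that of the label of the leaf reached. The protocol is one-round if either only Alice speaks and only Bob answers, or only Bob speaks and only Alice answers. For $g:X\times Y\to Z$ let $\mathrm{CC}(g)$ (resp. $\mathrm{CC}_1(g)$) be the minimal depth of a protocol (resp. of a one-round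 protocol) computing $g$, and put $$\mathrm{CC}(\mathcal A)(n)=\max_{0\le i\le 2rn+1}\mathrm{CC}(f^n_i),\qquad \mathrm{CC}_1(\mathcal A)(n)=\max_{0\le i\le 2rn+1}\mathrm{CC}_1(f^n_i).$$ Proposition. There exists a CA $\mathcal A$ whose one-round communication complexity is exponential in its communication complexity: $\mathrm{CC}(\mathcal A)(n)\to\infty$ as $n\to\infty$ and $\mathrm{CC}_1(\mathcal A)(n)=2^{\Theta(\mathrm{CC}(\mathcal A)(n))}$, that is, there are constants $a,b>0$ such that for all sufficiently large $n$ $$2^{a\,\mathrm{CC}(\mathcal A)(n)}\;\le\;\mathrm{CC}_1(\mathcal A)(n)\;\le\;2^{b\,\mathrm{CC}(\mathcal A)(n)}.$$ -/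

import Mathlib

open Filter

/-- A (deterministic, two-player) communication protocol over domain `X × Y` and range `Z`:
a binary tree whose internal nodes are labelled by a bit depending on the input of Alice
(`X`) or of Bob (`Y`), and whose leaves are labelled by the value announced by Alice or by Bob,
as a function of her or his own input. -/
inductive Protocol (X Y Z : Type) : Type where
  | leafA (A : X → Z) : Protocol X Y Z
  | leafB (B : Y → Z) : Protocol X Y Z
  | nodeA (a : X → Bool) (left right : Protocol X Y Z) : Protocol X Y Z
  | nodeB (b : Y → Bool) (left right : Protocol X Y Z) : Protocol X Y Z

namespace Protocol

variable {X Y Z : Type}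

/-- The value of a protocol on an input: walk from the root, left on bit `0` (`false`) and right
on bit `1` (`true`), and evaluate the label of the leaf that is reached. -/
def value : Protocol X Y Z → X → Y → Z
  | leafA A, x, _ => A x
  | leafB B, _, y => B y
  | nodeA a l r, x, y => if a x then r.value x y else l.value x y
  | nodeB b l r, x, y => if b y then r.value x y else l.value x y

/-- The depth of the tree: the largest number of bits exchanged along a branch. -/
def depth : Protocol X Y Z → ℕ
  | leafA _ => 0
  | leafB _ => 0
  | nodeA _ l r => max l.depth r.depth + 1
  | nodeB _ l r => max l.depth r.depth + 1

/-- The protocol computes `f`. -/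
def Computes (P : Protocol X Y Z) (f : X → Y → Z) : Prop :=
  ∀ x y, P.value x y = f x y

/-- Only Alice speaks, and Bob gives the final value. -/
def AliceToBob : Protocol X Y Z → Prop
  | leafA _ => False
  | leafB _ => True
  | nodeA _ l r => l.AliceToBob ∧ r.AliceToBob
  | nodeB _ _ _ => False

/-- Only Bob speaks, and Alice gives the final value. -/
def BobToAlice : Protocol X Y Z → Prop
  | leafA _ => True
  | leafB _ => False
  | nodeA _ _ _ => False
  | nodeB _ l r => l.BobToAlice ∧ r.BobToAlice

/-- One-round protocols: communication goes in one direction only, and the player who listens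
gives the final value. -/
def OneRound (P : Protocol X Y Z) : Prop :=
  P.AliceToBob ∨ P.BobToAlice

/-- For a finite nonempty `X`, every function is computed by a one-round protocol; so the minima
below are taken over nonempty sets. -/
theorem exists_oneRound_computes [Finite X] [Nonempty X] (f : X → Y → Z) :
    ∃ P : Protocol X Y Z, P.OneRound ∧ P.Computes f := by
  classical
  obtain ⟨x₀⟩ := ‹Nonempty X›
  have key : ∀ l : List X, ∃ P : Protocol X Y Z, P.AliceToBob ∧
      ∀ x ∈ l, ∀ y, P.value x y = f x y := by
    intro l
    induction l with
    | nil => exact ⟨leafB (f x₀), trivial, by simp⟩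
    | cons c l ih =>
      obtain ⟨P, hP, hv⟩ := ih
      refine ⟨nodeA (fun x => decide (x = c)) P (leafB (f c)), ⟨hP, trivial⟩, ?_⟩
      intro x hx y
      by_cases h : x = c
      · subst h
        simp [value]
      · have hx' : x ∈ l := by simpa [h] using hx
        simp [value, h, hv x hx' y]
  have := Fintype.ofFinite X
  obtain ⟨P, hP, hv⟩ := key (Finset.univ : Finset X).toList
  exact ⟨P, Or.inl hP, fun x y => hv x (by simp) y⟩

end Protocol

/-- The deterministic communication complexity `CC(f)`: the minimal depth of a protocol
computing `f`. -/
noncomputable def commComplexity {X Y Z : Type} (f : X → Y → Z) : ℕ :=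
  sInf {d | ∃ P : Protocol X Y Z, P.Computes f ∧ P.depth = d}

/-- The one-round deterministic communication complexity `CC₁(f)`: the minimal depth of a
one-round protocol computing `f`. -/
noncomputable def oneRoundCommComplexity {X Y Z : Type} (f : X → Y → Z) : ℕ :=
  sInf {d | ∃ P : Protocol X Y Z, P.OneRound ∧ P.Computes f ∧ P.depth = d}

/-- A one-dimensional cellular automaton `(S, r, f)`: a finite state set, a radius, and a local
transition function `f : S ^ (2r+1) → S`. -/
structure CellularAutomaton where
  State : Type
  finite_state : Finite State
  radius : ℕ
  rule : (Fin (2 * radius + 1) → State) → State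

namespace CellularAutomaton

/-- The `n`-th iteration `fⁿ : S ^ (2rn+1) → S` of the local rule: apply the local rule to each
window of `2r+1` consecutive letters, then apply the previous iteration to the resulting word.
(`f⁰` reads the only letter, so that `f¹ = f`.) -/
def iter (A : CellularAutomaton) : (n : ℕ) → (Fin (2 * A.radius * n + 1) → A.State) → A.State
  | 0, w => w 0
  | n + 1, w => A.iter n fun j => A.rule fun k =>
      w ⟨j.val + k.val, by have := j.isLt; have := k.isLt; rw [Nat.mul_succ]; omega⟩

/-- The function `fⁿᵢ : S ^ i × S ^ (2rn+1-i) → S`: Alice holds the first `i` letters of the word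
of length `2rn+1`, Bob holds the others. -/
def splitIter (A : CellularAutomaton) (n i : ℕ) (x : Fin i → A.State)
    (y : Fin (2 * A.radius * n + 1 - i) → A.State) : A.State :=
  A.iter n fun j =>
    if h : j.val < i then x ⟨j.val, h⟩
    else y ⟨j.val - i, by have := j.isLt; omega⟩

/-- The communication complexity of `A`: `n ↦ max_{0 ≤ i ≤ 2rn+1} CC(fⁿᵢ)`. -/
noncomputable def cc (A : CellularAutomaton) (n : ℕ) : ℕ :=
  (Finset.range (2 * A.radius * n + 2)).sup fun i => commComplexity (A.splitIter n i)

/-- The one-round communication complexity of `A`: `n ↦ max_{0 ≤ i ≤ 2rn+1} CC₁(fⁿᵢ)`. -/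
noncomputable def oneRoundCC (A : CellularAutomaton) (n : ℕ) : ℕ :=
  (Finset.range (2 * A.radius * n + 2)).sup fun i => oneRoundCommComplexity (A.splitIter n i)

end CellularAutomaton

/-! In `crossCA` two bit streams cross: at time `t` the center `n` sees `u` from cell `n - t` and
`v` from cell `n + t`. After `n` steps, `p` holds the `u` that came with the last `v = 1`, and `q`
symmetrically. Each register is thus an indexing problem, one player owning the table and the other
the index. Cut at `n`, `p` has the table with Alice and `q` has it with Bob, so either direction of
one-round communication costs `n - 1` bits (`pred_le_oneRoundCommComplexity_crossSplit`). With two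
rounds it suffices to agree on the two meeting times, in `O(log n)` bits
(`commComplexity_crossSplit_le`). Conversely, for any function Alice may send her whole strategy in
an optimal tree, so one round is at most exponentially worse
(`oneRoundCommComplexity_le_mul_two_pow`). This gives the upper bound and, with `n - 1` below,
forces `cc` to infinity. -/

/-! ### Protocols and the messages they encode -/

namespace Protocol

variable {X Y Z : Type}

/-- Exchange the roles of the two players. -/
def swap : Protocol X Y Z → Protocol Y X Z
  | leafA A => leafB A
  | leafB B => leafA B
  | nodeA a l r => nodeB a l.swap r.swap
  | nodeB b l r => nodeA b l.swap r.swap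

theorem value_swap (P : Protocol X Y Z) (x : X) (y : Y) : P.swap.value y x = P.value x y := by
  induction P with
  | leafA A => rfl
  | leafB B => rfl
  | nodeA a l r hl hr => simp [swap, value, hl, hr]
  | nodeB b l r hl hr => simp [swap, value, hl, hr]

theorem depth_swap (P : Protocol X Y Z) : P.swap.depth = P.depth := by
  induction P with
  | leafA A => rfl
  | leafB B => rfl
  | nodeA a l r hl hr => simp [swap, depth, hl, hr]
  | nodeB b l r hl hr => simp [swap, depth, hl, hr]

theorem aliceToBob_swap {P : Protocol X Y Z} (h : P.BobToAlice) : P.swap.AliceToBob := by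
  induction P with
  | leafA A => trivial
  | leafB B => exact h.elim
  | nodeA a l r hl hr => exact h.elim
  | nodeB b l r hl hr => exact ⟨hl h.1, hr h.2⟩

/-- Alice first sends `k` bits, after which the players follow a protocol that depends on them. -/
theorem exists_nodeA_bits (d : ℕ) : ∀ (k : ℕ) (s : X → Fin k → Bool)
    (P : (Fin k → Bool) → Protocol X Y Z), (∀ m, (P m).depth ≤ d) →
    ∃ Q : Protocol X Y Z, Q.depth ≤ k + d ∧ ((∀ m, (P m).AliceToBob) → Q.AliceToBob) ∧
      ∀ x y, Q.value x y = (P (s x)).value x y := by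
  intro k
  induction k with
  | zero =>
    intro s P hP
    refine ⟨P 0, by simpa using hP 0, fun h => h 0, fun x y => ?_⟩
    rw [Subsingleton.elim (s x) 0]
  | succ k ih =>
    intro s P hP
    have key := fun b : Bool => ih (fun x => Fin.tail (s x)) (fun m => P (Fin.cons b m))
      (fun m => hP _)
    obtain ⟨L, hLd, hLo, hLv⟩ := key false
    obtain ⟨R, hRd, hRo, hRv⟩ := key true
    refine ⟨nodeA (fun x => s x 0) L R, ?_,
      fun h => ⟨hLo fun m => h _, hRo fun m => h _⟩, fun x y => ?_⟩
    · simp only [depth]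
      omega
    · have hs : (Fin.cons (s x 0) (Fin.tail (s x)) : Fin (k + 1) → Bool) = s x :=
        Fin.cons_self_tail _
      cases h : s x 0 with
      | false =>
        rw [h] at hs
        simp [value, h, hLv, hs]
      | true =>
        rw [h] at hs
        simp [value, h, hRv, hs]

/-- Alice first sends a message from a set of at most `2 ^ k` messages, after which the players
follow a protocol that depends on it. -/
theorem exists_sendA {M : Type} [Fintype M] [Nonempty M] {k d : ℕ}
    (hM : Fintype.card M ≤ 2 ^ k) (s : X → M)
    (P : M → Protocol X Y Z) (hP : ∀ m, (P m).depth ≤ d) :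
    ∃ Q : Protocol X Y Z, Q.depth ≤ k + d ∧ ((∀ m, (P m).AliceToBob) → Q.AliceToBob) ∧
      ∀ x y, Q.value x y = (P (s x)).value x y := by
  classical
  obtain ⟨e⟩ : Nonempty (M ↪ (Fin k → Bool)) :=
    Function.Embedding.nonempty_of_card_le (by simpa using hM)
  obtain ⟨Q, hd, ho, hv⟩ := exists_nodeA_bits d k (fun x => e (s x))
    (fun m => P (Function.invFun e m)) (fun m => hP _)
  refine ⟨Q, hd, fun h => ho fun m => h _, fun x y => ?_⟩
  rw [hv, Function.leftInverse_invFun e.injective]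

/-- Bob first sends a message from a set of at most `2 ^ k` messages, after which the players
follow a protocol that depends on it. -/
theorem exists_sendB {M : Type} [Fintype M] [Nonempty M] {k d : ℕ}
    (hM : Fintype.card M ≤ 2 ^ k) (s : Y → M)
    (P : M → Protocol X Y Z) (hP : ∀ m, (P m).depth ≤ d) :
    ∃ Q : Protocol X Y Z, Q.depth ≤ k + d ∧ ∀ x y, Q.value x y = (P (s y)).value x y := by
  obtain ⟨Q, hd, -, hv⟩ := exists_sendA hM s (fun m => (P m).swap)
    (fun m => (depth_swap _).trans_le (hP m))
  exact ⟨Q.swap, (depth_swap Q).trans_le hd, fun x y => by rw [value_swap, hv, value_swap]⟩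

/-- In a protocol where only Alice speaks, her messages number at most `2 ^ depth`. -/
theorem exists_message_of_aliceToBob (P : Protocol X Y Z) (hP : P.AliceToBob) :
    ∃ (M : Type) (_ : Fintype M) (s : X → M) (g : M → Y → Z),
      Fintype.card M ≤ 2 ^ P.depth ∧ ∀ x y, P.value x y = g (s x) y := by
  induction P with
  | leafA A => exact hP.elim
  | leafB B => exact ⟨Unit, inferInstance, fun _ => (), fun _ => B, by simp [depth], fun _ _ => rfl⟩
  | nodeA a l r hl hr =>
    obtain ⟨M, _, s, g, hM, hv⟩ := hl hP.1
    obtain ⟨M', _, s', g', hM', hv'⟩ := hr hP.2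
    refine ⟨M ⊕ M', inferInstance, fun x => if a x then .inr (s' x) else .inl (s x),
      Sum.elim g g', ?_, fun x y => ?_⟩
    · have h := Nat.pow_le_pow_right two_pos (le_max_left l.depth r.depth)
      have h' := Nat.pow_le_pow_right two_pos (le_max_right l.depth r.depth)
      simp only [Fintype.card_sum, depth, pow_succ]
      omega
    · cases h : a x <;> simp [value, h, hv, hv']
  | nodeB b l r hl hr => exact hP.elim

/-- The function computed by a protocol depends on Alice's input only through one of
`|Z| ^ 2 ^ depth` messages: her strategy in the tree. -/
theorem exists_message [Fintype Z] (hZ : 2 ≤ Fintype.card Z) (P : Protocol X Y Z) :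
    ∃ (M : Type) (_ : Fintype M) (s : X → M) (g : M → Y → Z),
      Fintype.card M ≤ Fintype.card Z ^ 2 ^ P.depth ∧ ∀ x y, P.value x y = g (s x) y := by
  have mono : ∀ {a b : ℕ}, a ≤ b → Fintype.card Z ^ 2 ^ a ≤ Fintype.card Z ^ 2 ^ b := fun h =>
    Nat.pow_le_pow_right (by omega) (Nat.pow_le_pow_right two_pos h)
  have sq : ∀ m : ℕ, Fintype.card Z ^ 2 ^ (m + 1)
      = Fintype.card Z ^ 2 ^ m * Fintype.card Z ^ 2 ^ m := fun m => by
    rw [← pow_add, pow_succ, mul_two]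
  induction P with
  | leafA A => exact ⟨Z, inferInstance, A, fun z _ => z, by simp [depth], fun _ _ => rfl⟩
  | leafB B =>
    exact ⟨Unit, inferInstance, fun _ => (), fun _ => B, by simp [depth]; omega, fun _ _ => rfl⟩
  | nodeA a l r hl hr =>
    obtain ⟨M, _, s, g, hM, hv⟩ := hl
    obtain ⟨M', _, s', g', hM', hv'⟩ := hr
    refine ⟨M ⊕ M', inferInstance, fun x => if a x then .inr (s' x) else .inl (s x),
      Sum.elim g g', ?_, fun x y => ?_⟩
    · have h := mono (le_max_left l.depth r.depth)
      have h' := mono (le_max_right l.depth r.depth)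
      have h2 : 2 ≤ Fintype.card Z ^ 2 ^ max l.depth r.depth :=
        hZ.trans (Nat.le_self_pow (by positivity) _)
      simp only [Fintype.card_sum, depth, sq]
      -- A sum of two numbers at most `T` is at most `T * T`, because `2 ≤ T`.
      nlinarith
    · cases h : a x <;> simp [value, h, hv, hv']
  | nodeB b l r hl hr =>
    obtain ⟨M, _, s, g, hM, hv⟩ := hl
    obtain ⟨M', _, s', g', hM', hv'⟩ := hr
    -- Alice does not know Bob's bit, so her strategy must cover both subtrees.
    refine ⟨M × M', inferInstance, fun x => (s x, s' x),
      fun m y => if b y then g' m.2 y else g m.1 y, ?_, fun x y => ?_⟩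
    · simp only [Fintype.card_prod, depth, sq]
      exact Nat.mul_le_mul (hM.trans (mono (le_max_left _ _))) (hM'.trans (mono (le_max_right _ _)))
    · cases h : b y <;> simp [value, h, hv, hv']

end Protocol

/-! ### General bounds on the two complexities -/

section Complexity

variable {X Y Z : Type}

theorem commComplexity_le {f : X → Y → Z} {P : Protocol X Y Z} (h : P.Computes f) :
    commComplexity f ≤ P.depth :=
  Nat.sInf_le ⟨P, h, rfl⟩

theorem oneRoundCommComplexity_le {f : X → Y → Z} {P : Protocol X Y Z} (ho : P.OneRound)
    (h : P.Computes f) : oneRoundCommComplexity f ≤ P.depth :=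
  Nat.sInf_le ⟨P, ho, h, rfl⟩

theorem exists_depth_eq_commComplexity [Finite X] [Nonempty X] (f : X → Y → Z) :
    ∃ P : Protocol X Y Z, P.Computes f ∧ P.depth = commComplexity f :=
  Nat.sInf_mem (s := {d | ∃ P : Protocol X Y Z, P.Computes f ∧ P.depth = d})
    (by
      obtain ⟨P, -, h⟩ := Protocol.exists_oneRound_computes f
      exact ⟨_, P, h, rfl⟩)

theorem exists_depth_eq_oneRoundCommComplexity [Finite X] [Nonempty X] (f : X → Y → Z) :
    ∃ P : Protocol X Y Z, P.OneRound ∧ P.Computes f ∧ P.depth = oneRoundCommComplexity f :=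
  Nat.sInf_mem (s := {d | ∃ P : Protocol X Y Z, P.OneRound ∧ P.Computes f ∧ P.depth = d})
    (by
      obtain ⟨P, ho, h⟩ := Protocol.exists_oneRound_computes f
      exact ⟨_, P, ho, h, rfl⟩)

/-- One round costs at most exponentially more than an arbitrary protocol. -/
theorem oneRoundCommComplexity_le_mul_two_pow [Finite X] [Nonempty X] [Fintype Z] {k : ℕ}
    (hZ : 2 ≤ Fintype.card Z) (hk : Fintype.card Z ≤ 2 ^ k) (f : X → Y → Z) :
    oneRoundCommComplexity f ≤ k * 2 ^ commComplexity f := by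
  obtain ⟨P, hP, hd⟩ := exists_depth_eq_commComplexity f
  obtain ⟨M, _, s, g, hM, hv⟩ := P.exists_message hZ
  rw [hd] at hM
  have : Nonempty M := Nonempty.map s inferInstance
  obtain ⟨Q, hQd, hQo, hQv⟩ := Protocol.exists_sendA (k := k * 2 ^ commComplexity f)
    (hM.trans (by rw [pow_mul]; exact Nat.pow_le_pow_left hk _)) s
    (fun m => Protocol.leafB (X := X) (g m)) (d := 0) (fun m => le_rfl)
  refine (oneRoundCommComplexity_le (Or.inl (hQo fun m => trivial)) fun x y => ?_).trans hQd
  rw [hQv, ← hP x y, hv]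
  rfl

/-- If Bob can read off any of `m` bits chosen freely by Alice, and Alice any of `m` bits chosen
freely by Bob, then one round requires `m` bits. -/
theorem le_oneRoundCommComplexity [Finite X] [Nonempty X] {m : ℕ} (f : X → Y → Z)
    (x : (Fin m → Bool) → X) (y : Fin m → Y) (o : Z → Bool)
    (h : ∀ φ j, o (f (x φ) (y j)) = φ j)
    (y' : (Fin m → Bool) → Y) (x' : Fin m → X) (o' : Z → Bool)
    (h' : ∀ φ j, o' (f (x' j) (y' φ)) = φ j) :
    m ≤ oneRoundCommComplexity f := by
  have key : ∀ {X Y : Type} (f : X → Y → Z) (x : (Fin m → Bool) → X) (y : Fin m → Y)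
      (o : Z → Bool), (∀ φ j, o (f (x φ) (y j)) = φ j) →
      ∀ P : Protocol X Y Z, P.AliceToBob → P.Computes f → m ≤ P.depth := by
    intro X Y f x y o h P ho hP
    obtain ⟨M, _, s, g, hM, hv⟩ := P.exists_message_of_aliceToBob ho
    -- The message alone lets Bob recover every bit `φ j`, so distinct `φ` need distinct messages.
    have hinj : Function.Injective fun φ => s (x φ) := by
      intro φ ψ hφ
      funext j
      rw [← h φ j, ← h ψ j, ← hP, ← hP, hv, hv]
      exact congrArg (fun m => o (g m (y j))) hφ
    have hcard := (Fintype.card_le_of_injective _ hinj).trans hM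
    exact (Nat.pow_le_pow_iff_right one_lt_two).1 (by simpa using hcard)
  obtain ⟨P, ho | ho, hP, hd⟩ := exists_depth_eq_oneRoundCommComplexity f
  · exact hd ▸ key f x y o h P ho hP
  · rw [← hd, ← P.depth_swap]
    exact key (fun y x => f x y) y' x' o' h' P.swap (Protocol.aliceToBob_swap ho)
      fun y x => (P.value_swap x y).trans (hP x y)

end Complexity

/-! ### Last meeting times -/

/-- The last time `t < n` with `v t`, increased by one; `0` if there is none. -/
def lastHit (v : ℕ → Bool) : ℕ → ℕ
  | 0 => 0
  | n + 1 => if v n then n + 1 else lastHit v n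

theorem lastHit_le (v : ℕ → Bool) (n : ℕ) : lastHit v n ≤ n := by
  induction n with
  | zero => rfl
  | succ n ih =>
    rw [lastHit]
    split_ifs <;> omega

/-- Makes the joint meeting time computable from one number per player. -/
theorem lastHit_or (v v' : ℕ → Bool) (n : ℕ) :
    lastHit (fun t => v t || v' t) n = max (lastHit v n) (lastHit v' n) := by
  induction n with
  | zero => rfl
  | succ n ih =>
    have := lastHit_le v n
    have := lastHit_le v' n
    cases h : v n <;> cases h' : v' n <;> simp [lastHit, h, h', ih] <;> omega

/-- Peels off time `0` instead of the last time, since `iter` applies the rule to the initial word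
first. -/
theorem lastHit_succ_eq_shift (v : ℕ → Bool) (n : ℕ) :
    lastHit v (n + 1) = if lastHit (fun t => v (t + 1)) n = 0 then (if v 0 then 1 else 0)
      else lastHit (fun t => v (t + 1)) n + 1 := by
  induction n with
  | zero => simp [lastHit]
  | succ n ih =>
    rw [lastHit, ih, lastHit]
    cases h : v (n + 1) <;> simp

theorem lastHit_eq_of_unique {v : ℕ → Bool} {n s : ℕ} (hs : s < n)
    (h : ∀ t < n, v t = decide (t = s)) : lastHit v n = s + 1 := by
  induction n with
  | zero => omega
  | succ n ih =>
    rw [lastHit, h n n.lt_succ_self]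
    rcases Nat.lt_succ_iff_lt_or_eq.1 hs with hlt | rfl
    · simp [hlt.ne', ih hlt fun t ht => h t (ht.trans n.lt_succ_self)]
    · simp

theorem lastHit_eq_zero {v : ℕ → Bool} {n : ℕ} (h : ∀ t < n, v t = false) : lastHit v n = 0 := by
  induction n with
  | zero => rfl
  | succ n ih => simp [lastHit, h n n.lt_succ_self, ih fun t ht => h t (ht.trans n.lt_succ_self)]

/-! ### The crossing automaton and its closed form -/

/-- A cell carries a bit `u` travelling to the right, a bit `v` travelling to the left, and two
registers. -/
structure CrossCell where
  u : Bool
  v : Bool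
  p : Bool
  q : Bool
  deriving Fintype

namespace CrossCell

/-- The cell with all bits `0`. -/
def zero : CrossCell := ⟨false, false, false, false⟩

instance : Nonempty CrossCell := ⟨zero⟩

/-- Bitwise disjunction. -/
def merge (c c' : CrossCell) : CrossCell := ⟨c.u || c'.u, c.v || c'.v, c.p || c'.p, c.q || c'.q⟩

theorem zero_merge (c : CrossCell) : zero.merge c = c := by simp [merge, zero]

theorem merge_zero (c : CrossCell) : c.merge zero = c := by simp [merge, zero]

/-- The register `p` stores the bit `u` whenever it meets `v = 1`, and `q` stores `v` whenever it
meets `u = 1`. -/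
def next (l c r : CrossCell) : CrossCell :=
  ⟨l.u, r.v, if c.v then c.u else c.p, if c.u then c.v else c.q⟩

/-- The last meeting of `v = 1` with the center `n`. -/
def hitV (n : ℕ) (z : ℕ → CrossCell) : ℕ := lastHit (fun t => (z (n + t)).v) n

/-- The last meeting of `u = 1` with the center `n`. -/
def hitU (n : ℕ) (z : ℕ → CrossCell) : ℕ := lastHit (fun t => (z (n - t)).u) n

/-- The cell at the center `n` after `n` steps, in terms of the times of the last meetings. -/
def view (n : ℕ) (z : ℕ → CrossCell) (a b : ℕ) : CrossCell where
  u := (z 0).u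
  v := (z (2 * n)).v
  -- A meeting at time `t` is encoded as `a = t + 1`, so `n + 1 - a` is the cell `n - t`; with `a =
  -- 0` the register was never overwritten.
  p := if a = 0 then (z n).p else (z (n + 1 - a)).u
  q := if b = 0 then (z n).q else (z (n + b - 1)).v

/-- For fixed times, `view` only selects bits of the word, hence commutes with disjunction. -/
theorem view_merge (n : ℕ) (z z' : ℕ → CrossCell) (a b : ℕ) :
    view n (fun j => (z j).merge (z' j)) a b = (view n z a b).merge (view n z' a b) := by
  by_cases ha : a = 0 <;> by_cases hb : b = 0 <;> simp [view, merge, ha, hb]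

/-- A step shifts all meetings one unit earlier; a meeting at time `0` disappears, but its effect is
already in the registers of the new word. -/
theorem view_next (n : ℕ) (z : ℕ → CrossCell) :
    view n (fun j => next (z j) (z (j + 1)) (z (j + 2)))
      (hitV n fun j => next (z j) (z (j + 1)) (z (j + 2)))
      (hitU n fun j => next (z j) (z (j + 1)) (z (j + 2))) =
    view (n + 1) z (hitV (n + 1) z) (hitU (n + 1) z) := by
  have hV : hitV n (fun j => next (z j) (z (j + 1)) (z (j + 2)))
      = lastHit (fun t => (z (n + 1 + (t + 1))).v) n := by
    refine congrArg (fun f => lastHit f n) (funext fun t => ?_)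
    rw [show n + 1 + (t + 1) = n + t + 2 by omega]
    rfl
  have hU : hitU n (fun j => next (z j) (z (j + 1)) (z (j + 2)))
      = lastHit (fun t => (z (n + 1 - (t + 1))).u) n := by
    refine congrArg (fun f => lastHit f n) (funext fun t => ?_)
    rw [Nat.add_sub_add_right]
    rfl
  rw [hV, hU, hitV, hitU, lastHit_succ_eq_shift, lastHit_succ_eq_shift]
  generalize lastHit (fun t => (z (n + 1 + (t + 1))).v) n = a
  generalize lastHit (fun t => (z (n + 1 - (t + 1))).u) n = b
  rw [view, view, CrossCell.mk.injEq]
  refine ⟨rfl, rfl, ?_, ?_⟩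
  · cases hv : (z (n + 1)).v <;> cases a <;> simp [next, hv]
  · cases hu : (z (n + 1)).u <;> rcases b with _ | b <;> simp [next, hu]
    all_goals rw [show n + 1 + (b + 1) = n + b + 2 by omega]

end CrossCell

open CrossCell

/-- Two streams of bits crossing each other, each leaving a trace of what it met. -/
def crossCA : CellularAutomaton where
  State := CrossCell
  finite_state := inferInstance
  radius := 1
  rule w := next (w 0) (w 1) (w 2)

theorem crossCA_iter (n : ℕ) (z : ℕ → CrossCell) :
    crossCA.iter n (fun j => z j) = view n z (hitV n z) (hitU n z) := by
  induction n generalizing z with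
  | zero => rfl
  | succ n ih =>
    rw [← view_next, ← ih]
    rfl

/-! ### Communication bounds for the crossing automaton -/

/-- Alice's part of the word, completed by zeros. -/
def aliceWord {i : ℕ} (x : Fin i → CrossCell) (j : ℕ) : CrossCell :=
  if h : j < i then x ⟨j, h⟩ else zero

/-- Bob's part of the word, completed by zeros. -/
def bobWord (i : ℕ) {m : ℕ} (y : Fin m → CrossCell) (j : ℕ) : CrossCell :=
  if h : i ≤ j ∧ j - i < m then y ⟨j - i, h.2⟩ else zero

/-- The iterates of `crossCA`, as functions of the two parts of the word. -/
def crossSplit (n i : ℕ) (x : Fin i → CrossCell) (y : Fin (2 * 1 * n + 1 - i) → CrossCell) :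
    CrossCell :=
  crossCA.splitIter n i x y

/-- The word is the disjunction of the two zero-padded parts: the players interact only through the
maxima of their times. -/
theorem crossSplit_eq (n i : ℕ) (x : Fin i → CrossCell)
    (y : Fin (2 * 1 * n + 1 - i) → CrossCell) :
    crossSplit n i x y =
      (view n (aliceWord x) (max (hitV n (aliceWord x)) (hitV n (bobWord i y)))
        (max (hitU n (aliceWord x)) (hitU n (bobWord i y)))).merge
      (view n (bobWord i y) (max (hitV n (aliceWord x)) (hitV n (bobWord i y)))
        (max (hitU n (aliceWord x)) (hitU n (bobWord i y)))) := by
  rw [← view_merge]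
  have hV : max (hitV n (aliceWord x)) (hitV n (bobWord i y))
      = hitV n (fun j => (aliceWord x j).merge (bobWord i y j)) := (lastHit_or _ _ _).symm
  have hU : max (hitU n (aliceWord x)) (hitU n (bobWord i y))
      = hitU n (fun j => (aliceWord x j).merge (bobWord i y j)) := (lastHit_or _ _ _).symm
  rw [hV, hU, ← crossCA_iter]
  unfold crossSplit CellularAutomaton.splitIter
  congr 1
  funext ⟨j, hj⟩
  change j < 2 * 1 * n + 1 at hj
  by_cases h : j < i
  · have h' : ¬ (i ≤ j ∧ j - i < 2 * 1 * n + 1 - i) := by omega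
    rw [aliceWord, bobWord, dif_pos h, dif_neg h', merge_zero]
    exact dif_pos h
  · have h' : i ≤ j ∧ j - i < 2 * 1 * n + 1 - i := by omega
    rw [aliceWord, bobWord, dif_neg h, dif_pos h', zero_merge]
    exact dif_neg h

/-- Bob sends his two times (`2k` bits); Alice returns the joint times and her view at them (`2k +
4` bits); Bob merges in his own view. -/
theorem commComplexity_crossSplit_le (n i : ℕ) :
    commComplexity (crossSplit n i) ≤ 4 * Nat.clog 2 (n + 1) + 4 := by
  have hk : n + 1 ≤ 2 ^ Nat.clog 2 (n + 1) := Nat.le_pow_clog one_lt_two _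
  set k := Nat.clog 2 (n + 1)
  have hM : Fintype.card (Fin (n + 1) × Fin (n + 1)) ≤ 2 ^ (2 * k) := by
    simpa [two_mul, pow_add] using Nat.mul_le_mul hk hk
  have hM' : Fintype.card ((Fin (n + 1) × Fin (n + 1)) × CrossCell) ≤ 2 ^ (2 * k + 4) := by
    rw [Fintype.card_prod, pow_add]
    exact Nat.mul_le_mul hM (by decide)
  let times (z : ℕ → CrossCell) : Fin (n + 1) × Fin (n + 1) :=
    (⟨hitV n z, Nat.lt_succ_of_le (lastHit_le _ _)⟩, ⟨hitU n z, Nat.lt_succ_of_le (lastHit_le _ _)⟩)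
  let reply (m : Fin (n + 1) × Fin (n + 1)) (x : Fin i → CrossCell) :
      (Fin (n + 1) × Fin (n + 1)) × CrossCell :=
    (times (aliceWord x) ⊔ m, view n (aliceWord x) ↑(times (aliceWord x) ⊔ m).1
      ↑(times (aliceWord x) ⊔ m).2)
  let answer (m : (Fin (n + 1) × Fin (n + 1)) × CrossCell)
      (y : Fin (2 * 1 * n + 1 - i) → CrossCell) : CrossCell :=
    m.2.merge (view n (bobWord i y) m.1.1 m.1.2)
  choose R hRd _ hRv using fun m => Protocol.exists_sendA hM' (reply m)
    (fun m => Protocol.leafB (answer m)) (d := 0) (fun m => le_rfl)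
  obtain ⟨Q, hQd, hQv⟩ := Protocol.exists_sendB hM
    (fun y : Fin (2 * 1 * n + 1 - i) → CrossCell => times (bobWord i y)) R hRd
  refine (commComplexity_le (P := Q) fun x y => ?_).trans (hQd.trans (by omega))
  rw [hQv, hRv, crossSplit_eq]
  rfl

theorem pred_le_oneRoundCommComplexity_crossSplit (n : ℕ) :
    n - 1 ≤ oneRoundCommComplexity (crossSplit n n) := by
  have hitV_zero : ∀ z : ℕ → CrossCell, (∀ t < n, (z (n + t)).v = false) → hitV n z = 0 :=
    fun z h => lastHit_eq_zero h
  have hitU_zero : ∀ z : ℕ → CrossCell, (∀ t < n, (z (n - t)).u = false) → hitU n z = 0 :=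
    fun z h => lastHit_eq_zero h
  refine le_oneRoundCommComplexity (crossSplit n n)
    -- Bit `φ s` is placed to reach the center at time `s + 1`. Time `0` is skipped because cell `n`
    -- is Bob's, whence `n - 1` bits.
    (fun φ j => ⟨if h : n - j - 1 < n - 1 then φ ⟨n - j - 1, h⟩ else false, false, false, false⟩)
    (fun s j => ⟨false, decide (j.val = s + 1), false, false⟩) CrossCell.p ?_
    -- Truncated subtraction also puts `φ 0` at `j = 0`; that cell is not the one read, since the
    -- only meeting is at time `s + 1`.
    (fun φ j => ⟨false, if h : j - 1 < n - 1 then φ ⟨j - 1, h⟩ else false, false, false⟩)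
    (fun s j => ⟨decide (n - j.val = s + 1), false, false, false⟩) CrossCell.q ?_
  · intro φ ⟨s, hs⟩
    rw [crossSplit_eq, hitV_zero (aliceWord _), hitV, lastHit_eq_of_unique (s := s + 1)]
    · have h1 : 0 < n := by omega
      have h2 : n - (n - (s + 1)) - 1 = s := by omega
      simp [merge, view, aliceWord, bobWord, zero, h1, h2, hs]
    · omega
    · intro t ht
      have : t < 2 * n + 1 - n := by omega
      simp [bobWord, this]
    · intro t ht
      simp [aliceWord, zero]
  · intro φ ⟨s, hs⟩
    rw [crossSplit_eq, hitU_zero (bobWord _ _), hitU, lastHit_eq_of_unique (s := s + 1)]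
    · have h1 : n + (s + 1 + 1) - 1 = n + (s + 1) := by omega
      have h2 : s + 1 < 2 * n + 1 - n := by omega
      simp [merge, view, aliceWord, bobWord, zero, h1, h2, hs]
    · omega
    · intro t ht
      by_cases h : n - t < n
      · have : n - (n - t) = t := by omega
        simp [aliceWord, h, this]
      · have : t ≠ s + 1 := by omega
        simp [aliceWord, h, zero, this]
    · intro t ht
      by_cases h : n ≤ n - t ∧ n - t - n < 2 * 1 * n + 1 - n <;> simp only [bobWord, h] <;> simp [zero]

/-! ### Asymptotics -/

theorem crossCA_cc_le (n : ℕ) : crossCA.cc n ≤ 4 * Nat.clog 2 (n + 1) + 4 :=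
  Finset.sup_le fun i _ => commComplexity_crossSplit_le n i

theorem pred_le_crossCA_oneRoundCC (n : ℕ) : n - 1 ≤ crossCA.oneRoundCC n :=
  (pred_le_oneRoundCommComplexity_crossSplit n).trans <|
    Finset.le_sup (f := fun i => oneRoundCommComplexity (crossCA.splitIter n i))
      (Finset.mem_range.2 (by change n < 2 * 1 * n + 2; omega))

theorem crossCA_oneRoundCC_le (n : ℕ) : crossCA.oneRoundCC n ≤ 4 * 2 ^ crossCA.cc n := by
  refine Finset.sup_le fun i hi => ?_
  -- There are `2 ^ 4` states.
  refine (oneRoundCommComplexity_le_mul_two_pow (k := 4) (by decide) (by decide)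
    (crossSplit n i)).trans ?_
  exact Nat.mul_le_mul_left _ (Nat.pow_le_pow_right two_pos
    (Finset.le_sup (f := fun i => commComplexity (crossCA.splitIter n i)) hi))

theorem tendsto_crossCA_cc : Tendsto crossCA.cc atTop atTop := by
  refine tendsto_atTop.2 fun d => ?_
  filter_upwards [eventually_ge_atTop (4 * 2 ^ d + 2)] with n hn
  by_contra! h
  have h1 := (pred_le_crossCA_oneRoundCC n).trans (crossCA_oneRoundCC_le n)
  have h2 := Nat.pow_le_pow_right two_pos h.le
  omega

theorem mainTheorem3 :
    ∃ A : CellularAutomaton,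
      Tendsto A.cc atTop atTop ∧
      ∃ a b : ℝ, 0 < a ∧ 0 < b ∧
        ∀ᶠ n : ℕ in atTop,
          (2 : ℝ) ^ (a * (A.cc n : ℝ)) ≤ (A.oneRoundCC n : ℝ) ∧
          (A.oneRoundCC n : ℝ) ≤ (2 : ℝ) ^ (b * (A.cc n : ℝ)) := by
  refine ⟨crossCA, tendsto_crossCA_cc, 1 / 8, 2, by norm_num, by norm_num, ?_⟩
  filter_upwards [eventually_ge_atTop 8, tendsto_crossCA_cc.eventually_ge_atTop 2] with n hn hc
  constructor
  · have hk : 2 ^ Nat.clog 2 (n + 1) < 2 * (n + 1) := by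
      have := Nat.pow_pred_clog_lt_self one_lt_two (x := n + 1) (by omega)
      have hpos : 0 < Nat.clog 2 (n + 1) := Nat.clog_pos one_lt_two (by omega)
      obtain ⟨k, hk⟩ := Nat.exists_eq_succ_of_ne_zero hpos.ne'
      rw [hk] at this ⊢
      simp only [Nat.pred_succ] at this
      rw [Nat.succ_eq_add_one, pow_succ]
      omega
    have hone : ((n : ℝ) - 1) ≤ crossCA.oneRoundCC n := by
      have := pred_le_crossCA_oneRoundCC n
      have : n ≤ crossCA.oneRoundCC n + 1 := by omega
      have : (n : ℝ) ≤ crossCA.oneRoundCC n + 1 := by exact_mod_cast this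
      linarith
    refine le_trans ?_ hone
    have hn' : (8 : ℝ) ≤ n := by exact_mod_cast hn
    -- Squaring turns the exponent into `cc / 4`, at most `clog + 1`; it remains that `4 * (n + 1) ≤
    -- (n - 1) ^ 2`, true for `n ≥ 8`.
    refine le_of_sq_le_sq ?_ (by linarith)
    rw [← Real.rpow_natCast, ← Real.rpow_mul two_pos.le]
    have hcc : (crossCA.cc n : ℝ) ≤ 4 * (Nat.clog 2 (n + 1) : ℕ) + 4 := by
      exact_mod_cast crossCA_cc_le n
    calc (2 : ℝ) ^ (1 / 8 * (crossCA.cc n : ℝ) * (2 : ℕ))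
        ≤ (2 : ℝ) ^ ((Nat.clog 2 (n + 1) + 1 : ℕ) : ℝ) := by
          refine Real.rpow_le_rpow_of_exponent_le one_le_two ?_
          push_cast
          linarith
      _ = 2 ^ Nat.clog 2 (n + 1) * 2 := by rw [Real.rpow_natCast, pow_succ]
      _ ≤ 2 * (n + 1) * 2 := by
          have : (2 : ℝ) ^ Nat.clog 2 (n + 1) ≤ 2 * (n + 1) := by exact_mod_cast hk.le
          linarith
      _ ≤ ((n : ℝ) - 1) ^ 2 := by nlinarith
  · calc (crossCA.oneRoundCC n : ℝ) ≤ 4 * 2 ^ crossCA.cc n := by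
          exact_mod_cast crossCA_oneRoundCC_le n
      _ = (2 : ℝ) ^ (2 + crossCA.cc n) := by rw [pow_add]; norm_num
      -- The factor `4` is absorbed because `2 ≤ cc`.
      _ ≤ (2 : ℝ) ^ (2 * crossCA.cc n) := pow_le_pow_right₀ one_le_two (by omega)
      _ = (2 : ℝ) ^ (2 * (crossCA.cc n : ℝ)) := by rw [← Real.rpow_natCast]; push_cast; rfl
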